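/- Let $q$ be a prime power, let $1\le \ell\le q$ be an integer and let $\rho\in(0,1-\ell/q)$. Write $$h_{q,\ell}(\rho)=\rho\log_q\frac{q-\ell}{\rho}+(1-\rho)\log_q\frac{\ell}{1-\rho}.$$ A code $\mathcal C\subseteq\mathbb F_q^n$ is $(\rho,\ell,L)$-list-recoverable if for all $S_1,\dots,S_n\subseteq\mathbb F_q$ with $|S_i|\le \ell$ there are fewer than $L$ codewords $c\in\mathcal C$ with $\frac1n|\{i: c_i\notin S_i\}|\le\rho$. A random code in $\mathbb F_q^n$ of rate $R$ is a random subset of $\mathbb F_q^n$ that includes each vector independently with probability $q^{(R-1)n}$. With high probability (whp) means with probability tending to $1$ as $n\to\infty$, all other parameters being fixed. 1. For every $\delta>0$ there is $\varepsilon_0=\varepsilon_0(q,\ell,\rho,\delta)>0$ such that for all $0<\varepsilon<\varepsilon_0$, a random code in $\mathbb F_q^n$ of rate $1-h_{q,\ell}(\rho)-\varepsilon$ is whp not $\left(\rho,\ell,\left\lfloor \frac{\log_q\binom q\ell}{\varepsilon}-\delta\right\rfloor\right)$-list-recoverable. 2. For every $\varepsilon>0$, a random code in $\mathbb F_q^n$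 of rate $1-h_{q,\ell}(\rho)-\varepsilon$ is whp $\left(\rho,\ell,\left\lceil \frac{\log_q\binom q\ell}{\varepsilon}+1\right\rceil\right)$-list-recoverable. 3. Consequently, for every $\delta\in(0,1)$ there is $\varepsilon_0=\varepsilon_0(q,\ell,\rho,\delta)>0$ such that for all $0<\varepsilon<\varepsilon_0$, the smallest $L$ for which a random code in $\mathbb F_q^n$ of rate $1-h_{q,\ell}(\rho)-\varepsilon$ is $(\rho,\ell,L)$-list-recoverable is whp one of the two or three values $\left\lfloor \frac{\log_q\binom q\ell}{\varepsilon}+1-\delta\right\rfloor$, $\left\lceil \frac{\log_q\binom q\ell}{\varepsilon}\right\rceil$, $\left\lceil \frac{\log_q\binom q\ell}{\varepsilon}\right\rceil+1$. -/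

import Mathlib

open Filter Topology MeasureTheory ProbabilityTheory

noncomputable section

namespace ListRecovery

/-- The `(q, ℓ)`-entropy function
`h_{q,ℓ}(ρ) = ρ log_q ((q - ℓ) / ρ) + (1 - ρ) log_q (ℓ / (1 - ρ))`. -/
def entropy (q ℓ : ℕ) (ρ : ℝ) : ℝ :=
  ρ * Real.logb q (((q : ℝ) - ℓ) / ρ) + (1 - ρ) * Real.logb q ((ℓ : ℝ) / (1 - ρ))

open Classical in
/-- The relative distance of a vector `x` to a tuple `S = (S₁, …, Sₙ)` of subsets of the alphabet:
the fraction of the coordinates `i` with `x i ∉ S i`. -/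
def relDist {F : Type*} {n : ℕ} (x : Fin n → F) (S : Fin n → Finset F) : ℝ :=
  ((Finset.univ.filter fun i => x i ∉ S i).card : ℝ) / n

/-- A code `C ⊆ Fⁿ` is `(ρ, ℓ, L)`-list-recoverable if for all tuples of subsets of `F` of size at
most `ℓ`, fewer than `L` codewords are within relative distance `ρ` of the tuple. -/
def IsListRecoverable {F : Type*} {n : ℕ} (ρ : ℝ) (ℓ L : ℕ) (C : Set (Fin n → F)) : Prop :=
  ∀ S : Fin n → Finset F, (∀ i, (S i).card ≤ ℓ) → {c ∈ C | relDist c S ≤ ρ}.ncard < L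

/-- The inclusion probability `q^{(R-1)n}`, as an element of the unit interval. The truncation has
no effect for rates `R ≤ 1`. -/
def inclusionProb (q n : ℕ) (R : ℝ) : unitInterval :=
  Set.projIcc (0 : ℝ) 1 zero_le_one ((q : ℝ) ^ ((R - 1) * n))

theorem coe_inclusionProb {q n : ℕ} {R : ℝ} (hq : 1 ≤ q) (hR : R ≤ 1) :
    (inclusionProb q n R : ℝ) = (q : ℝ) ^ ((R - 1) * n) := by
  have h0 : (0 : ℝ) ≤ (q : ℝ) ^ ((R - 1) * n) := by positivity
  have h1 : (q : ℝ) ^ ((R - 1) * n) ≤ 1 :=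
    Real.rpow_le_one_of_one_le_of_nonpos (by exact_mod_cast hq)
      (mul_nonpos_of_nonpos_of_nonneg (by linarith) (Nat.cast_nonneg n))
  rw [inclusionProb, Set.projIcc_of_mem zero_le_one ⟨h0, h1⟩]

/-- The law of a random code in `Fⁿ` of rate `R` over an alphabet `F` of size `q`: each vector of
`Fⁿ` is included in the code independently with probability `q^{(R-1)n}`. -/
def randomCode (F : Type*) [Fintype F] (n : ℕ) (R : ℝ) : Measure (Set (Fin n → F)) :=
  setBernoulli Set.univ (inclusionProb (Fintype.card F) n R)

/-- A random code of rate `R` over `F` satisfies the property `P` with high probability, that is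
with probability `1 - o(1)` as the block length `n` tends to infinity. -/
def WithHighProb (F : Type*) [Fintype F] (R : ℝ)
    (P : ∀ n : ℕ, Set (Fin n → F) → Prop) : Prop :=
  Tendsto (fun n : ℕ => randomCode F n R {C | P n C}) atTop (𝓝 1)

end ListRecovery

end

noncomputable section

namespace ListRecovery

/-! ### Probability -/

/-! Write `N = q.choose ℓ`, `V = q ^ h` with `h` the entropy, and `p` for the inclusion probability,
so that `V ^ n * p = q ^ (-ε n)`. Failure of list-recoverability means that some `L`-element list
inside some ball is contained in the code. There are `N ^ n` centres with exactly `ℓ` symbols per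
coordinate, and each ball has `V ^ n` points up to a polynomial factor. The expected number of pairs
(centre, contained list) is therefore about `(N * q ^ (-ε L)) ^ n`, with threshold `L = log_q N /
ε`.

Above the threshold the union bound suffices. Below it Chebyshev is used, and the danger is pairs of
lists sharing `j ≥ 1` vectors. These lie in the intersection of two balls, and
`card_ball_inter_ball_le` shows that the intersection loses a factor `γ < 1` for every coordinate in
which the centres differ. Summing over centres factorizes, and relative to the squared mean the
`j`-th term is a polynomial in `n` times `(q ^ (ε j) * (1 + (N - 1) * γ ^ j) / N) ^ n`.

The base is convex in `j`, so it is below `1` on the whole range once it is at both ends. At `j = 1`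
this holds for small `ε` because `γ < 1`. At `j = log_q N / ε - δ` the gain `q ^ (-ε δ)`, linear in
`ε`, beats `γ ^ j`, which is exponentially small in `1 / ε` (`eventually_rpow_pow_mul_lt`). -/

/-- Under the Bernoulli measure on sets, a given finite set is included with probability
`p ^ #T`. -/
theorem setBernoulli_real_superset {α : Type*} (p : unitInterval) (T : Finset α) :
    (setBernoulli Set.univ p).real {C : Set α | (T : Set α) ⊆ C} = (p : ℝ) ^ T.card := by
  have hset : (fun f : α → Prop => {i | f i}) ⁻¹' {C : Set α | (T : Set α) ⊆ C} =
      Set.pi (T : Set α) fun _ => {True} := by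
    ext f
    simp [Set.subset_def, Set.pi]
  rw [measureReal_def, setBernoulli_apply', hset,
    Measure.infinitePi_pi _ fun _ _ => MeasurableSet.of_discrete]
  simp

/-- Chebyshev's inequality for the number of events that occur. -/
theorem measureReal_forall_notMem_mul_sq_le {Ω ι : Type*} [MeasurableSpace Ω]
    (μ : Measure Ω) [IsProbabilityMeasure μ] (s : Finset ι) (A : ι → Set Ω)
    (hA : ∀ i, MeasurableSet (A i)) :
    μ.real {ω | ∀ i ∈ s, ω ∉ A i} * (∑ i ∈ s, μ.real (A i)) ^ 2 ≤
      ∑ i ∈ s, ∑ j ∈ s, (μ.real (A i ∩ A j) - μ.real (A i) * μ.real (A j)) := by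
  set X : ι → Ω → ℝ := fun i => (A i).indicator 1 with hX
  have hmem : ∀ i, MemLp (X i) 2 μ := fun i =>
    (memLp_const (1 : ℝ)).indicator (hA i)
  have hint : ∀ i, ∫ ω, X i ω ∂μ = μ.real (A i) := fun i => integral_indicator_one (hA i)
  have hcov : ∀ i j, cov[X i, X j; μ] = μ.real (A i ∩ A j) - μ.real (A i) * μ.real (A j) := by
    intro i j
    rw [covariance_eq_sub (hmem i) (hmem j), hint, hint, ← integral_indicator_one
      ((hA i).inter (hA j)), Set.inter_indicator_one]
  set Y : Ω → ℝ := fun ω => ∑ i ∈ s, X i ω with hY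
  have hYmem : MemLp Y 2 μ := memLp_finsetSum s fun i _ => hmem i
  have hEY : ∫ ω, Y ω ∂μ = ∑ i ∈ s, μ.real (A i) := by
    rw [hY, integral_finsetSum _ fun i _ => (hmem i).integrable one_le_two]
    exact Finset.sum_congr rfl fun i _ => hint i
  have hvar : Var[Y; μ] =
      ∑ i ∈ s, ∑ j ∈ s, (μ.real (A i ∩ A j) - μ.real (A i) * μ.real (A j)) := by
    rw [hY, variance_fun_sum' fun i _ => hmem i]
    exact Finset.sum_congr rfl fun i _ => Finset.sum_congr rfl fun j _ => hcov i j
  rw [← hvar, ← hEY]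
  have hnonneg : 0 ≤ ∫ ω, Y ω ∂μ := by
    rw [hEY]
    exact Finset.sum_nonneg fun _ _ => measureReal_nonneg
  rcases hnonneg.eq_or_lt with h0 | hpos
  · simp [← h0, variance_nonneg]
  rw [← le_div_iff₀ (by positivity)]
  refine ENNReal.toReal_le_of_le_ofReal (div_nonneg (variance_nonneg _ _) (sq_nonneg _)) ?_
  -- If no event occurs then `Y = 0`, which deviates from the mean by the full mean.
  refine (measure_mono ?_).trans (meas_ge_le_variance_div_sq hYmem hpos)
  intro ω hω
  have : Y ω = 0 := Finset.sum_eq_zero fun i hi => by simp [hX, hω i hi]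
  simp only [Set.mem_ofPred_eq, this]
  simp [le_abs_self]

/-! ### Events of high probability -/

section WithHighProb

variable {F : Type*} [Fintype F] {R : ℝ} {P Q : ∀ n : ℕ, Set (Fin n → F) → Prop}

instance (n : ℕ) (R : ℝ) : IsProbabilityMeasure (randomCode F n R) := by
  unfold randomCode
  infer_instance

theorem measurableSet_of_finite_pi {n : ℕ} (A : Set (Set (Fin n → F))) : MeasurableSet A :=
  A.toFinite.measurableSet

theorem withHighProb_iff :
    WithHighProb F R P ↔
      Tendsto (fun n : ℕ => (randomCode F n R).real {C | ¬ P n C}) atTop (𝓝 0) := by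
  have key : ∀ n, (randomCode F n R).real {C | ¬ P n C} =
      1 - (randomCode F n R).real {C | P n C} := fun n =>
    probReal_compl_eq_one_sub (measurableSet_of_finite_pi {C | P n C})
  have h1 : WithHighProb F R P ↔
      Tendsto (fun n : ℕ => (randomCode F n R).real {C | P n C}) atTop (𝓝 1) := by
    unfold WithHighProb
    rw [← ENNReal.tendsto_toReal_iff (fun _ => measure_ne_top _ _) ENNReal.one_ne_top]
    rfl
  rw [h1]
  simp_rw [key]
  constructor
  · intro h
    simpa using h.const_sub 1
  · intro h
    simpa using h.const_sub 1

theorem WithHighProb.and (hP : WithHighProb F R P) (hQ : WithHighProb F R Q) :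
    WithHighProb F R fun n C => P n C ∧ Q n C := by
  rw [withHighProb_iff] at *
  refine squeeze_zero (fun _ => measureReal_nonneg) (fun n => ?_) (by simpa using hP.add hQ)
  refine (measureReal_mono (fun C hC => ?_) (measure_ne_top _ _)).trans (measureReal_union_le _ _)
  exact not_and_or.mp hC

theorem WithHighProb.mono (hP : WithHighProb F R P) (h : ∀ n C, P n C → Q n C) :
    WithHighProb F R Q := by
  rw [withHighProb_iff] at *
  exact squeeze_zero (fun _ => measureReal_nonneg)
    (fun n => measureReal_mono (fun C hC hP => hC (h n C hP)) (measure_ne_top _ _)) hP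

end WithHighProb

/-! ### Hamming balls around tuples of sets -/

/-- The weight `t` for which the `t`-tilted product distribution has relative distance `ρ` from a
tuple of `ℓ`-element sets. -/
def tilt (q ℓ : ℕ) (ρ : ℝ) : ℝ := ρ * ℓ / ((1 - ρ) * (q - ℓ))

/-- The factor by which the bound for the size of the intersection of two balls decreases with each
coordinate in which the centres differ. -/
def decay (q ℓ : ℕ) (ρ : ℝ) : ℝ := 1 - (1 - √(tilt q ℓ ρ)) ^ 2 * (1 - ρ) / ℓ

/-- The exponential growth rate of the size of a ball of relative radius `ρ`. -/
def growth (q ℓ : ℕ) (ρ : ℝ) : ℝ := (q : ℝ) ^ entropy q ℓ ρ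

/-! ### The tilting parameters -/

section Parameters

variable {q ℓ : ℕ} {ρ : ℝ}

theorem lt_of_lt_one_sub_div (hρ : 0 < ρ) (hρ' : ρ < 1 - (ℓ : ℝ) / q) (hℓ : 1 ≤ ℓ) (hℓq : ℓ ≤ q) :
    ρ < 1 ∧ (ℓ : ℝ) < q ∧ ρ * q < q - ℓ := by
  have hℓ0 : (1 : ℝ) ≤ ℓ := by exact_mod_cast hℓ
  have hℓq' : (ℓ : ℝ) ≤ q := by exact_mod_cast hℓq
  have hq0 : (0 : ℝ) < q := by linarith
  have h1 : ρ * q < q - ℓ := by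
    calc ρ * q < (1 - (ℓ : ℝ) / q) * q := by gcongr
      _ = q - ℓ := by field_simp
  have : 0 < ρ * q := by positivity
  refine ⟨?_, by linarith, h1⟩
  have : 0 < (ℓ : ℝ) / q := by positivity
  linarith

variable (hℓ : 1 ≤ ℓ) (hρ : 0 < ρ) (hρ1 : ρ < 1) (hℓq : (ℓ : ℝ) < q) (hρq : ρ * q < q - ℓ)
include hℓ hρ hρ1 hℓq

theorem tilt_pos : 0 < tilt q ℓ ρ := by
  have : (1 : ℝ) ≤ ℓ := by exact_mod_cast hℓ
  have h2 : 0 < 1 - ρ := by linarith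
  have h3 : (0 : ℝ) < q - ℓ := by linarith
  unfold tilt
  positivity

omit hρ in
theorem weight_eq : (ℓ : ℝ) + (q - ℓ) * tilt q ℓ ρ = ℓ / (1 - ρ) := by
  have h2 : 1 - ρ ≠ 0 := by linarith
  have h3 : (q : ℝ) - ℓ ≠ 0 := by linarith
  unfold tilt
  field_simp
  ring

/-- The Chernoff bound for a ball has base `t ^ (-ρ) * (ℓ + (q - ℓ) * t)` for weights `t ≤ 1`.
`tilt` is its minimizer, and the minimum is the entropy growth rate. -/
theorem growth_eq : growth q ℓ ρ = tilt q ℓ ρ ^ (-ρ) * (ℓ / (1 - ρ)) := by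
  have hℓ0 : (1 : ℝ) ≤ ℓ := by exact_mod_cast hℓ
  have h2 : 0 < 1 - ρ := by linarith
  have h3 : (0 : ℝ) < q - ℓ := by linarith
  have hq : (1 : ℝ) < q := by linarith
  have ht := tilt_pos hℓ hρ hρ1 hℓq
  have hW : (0 : ℝ) < ℓ / (1 - ρ) := by positivity
  have hlt : ((q : ℝ) - ℓ) / ρ = ℓ / (1 - ρ) / tilt q ℓ ρ := by
    unfold tilt
    field_simp
  unfold growth entropy
  rw [Real.rpow_add (by linarith), mul_comm ρ, mul_comm (1 - ρ), Real.rpow_mul (by linarith),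
    Real.rpow_mul (by linarith), Real.rpow_logb (by linarith) (by linarith) (by positivity),
    Real.rpow_logb (by linarith) (by linarith) hW, hlt, Real.div_rpow hW.le ht.le,
    Real.rpow_neg ht.le, Real.rpow_sub hW, Real.rpow_one]
  field_simp

include hρq

omit hℓ hρ in
theorem tilt_lt_one : tilt q ℓ ρ < 1 := by
  have h2 : 0 < 1 - ρ := by linarith
  have h3 : (0 : ℝ) < q - ℓ := by linarith
  unfold tilt
  rw [div_lt_one (by positivity)]
  nlinarith

theorem decay_pos : 0 < decay q ℓ ρ := by
  have hℓ0 : (1 : ℝ) ≤ ℓ := by exact_mod_cast hℓ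
  have h0 := Real.sqrt_nonneg (tilt q ℓ ρ)
  have h1 : √(tilt q ℓ ρ) < 1 := by
    rw [Real.sqrt_lt' one_pos]
    simpa using tilt_lt_one hρ1 hℓq hρq
  unfold decay
  rw [sub_pos, div_lt_one (by linarith)]
  have : (1 - √(tilt q ℓ ρ)) ^ 2 ≤ 1 := pow_le_one₀ (by linarith) (by linarith)
  nlinarith

omit hρ in
theorem decay_lt_one : decay q ℓ ρ < 1 := by
  have hℓ0 : (1 : ℝ) ≤ ℓ := by exact_mod_cast hℓ
  have h2 : 0 < 1 - ρ := by linarith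
  have h1 : √(tilt q ℓ ρ) < 1 := by
    rw [Real.sqrt_lt' one_pos]
    simpa using tilt_lt_one hρ1 hℓq hρq
  have h3 : 0 < 1 - √(tilt q ℓ ρ) := by linarith
  unfold decay
  have : 0 < (1 - √(tilt q ℓ ρ)) ^ 2 * (1 - ρ) / ℓ := by positivity
  linarith

theorem entropy_pos : 0 < entropy q ℓ ρ := by
  have hℓ0 : (1 : ℝ) ≤ ℓ := by exact_mod_cast hℓ
  have h2 : 0 < 1 - ρ := by linarith
  have hq : (1 : ℝ) < q := by linarith
  have ha : 1 < ((q : ℝ) - ℓ) / ρ := by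
    rw [lt_div_iff₀ hρ]
    nlinarith
  have hb : 1 < (ℓ : ℝ) / (1 - ρ) := by
    rw [lt_div_iff₀ h2]
    linarith
  have := Real.logb_pos hq ha
  have := Real.logb_pos hq hb
  unfold entropy
  positivity

theorem one_lt_growth : 1 < growth q ℓ ρ :=
  Real.one_lt_rpow (by linarith [show (1 : ℝ) ≤ ℓ by exact_mod_cast hℓ])
    (entropy_pos hℓ hρ hρ1 hℓq hρq)

end Parameters

variable {F : Type*} [Fintype F] {n : ℕ}

open Classical in
/-- The ball of relative radius `ρ` around a tuple of sets. -/
def ball (ρ : ℝ) (S : Fin n → Finset F) : Finset (Fin n → F) :=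
  Finset.univ.filter fun x => relDist x S ≤ ρ

/-- The tuples of `ℓ`-element sets. -/
def centers (F : Type*) [Fintype F] (n ℓ : ℕ) : Finset (Fin n → Finset F) :=
  Fintype.piFinset fun _ => Finset.powersetCard ℓ Finset.univ

theorem mem_centers {ℓ : ℕ} {S : Fin n → Finset F} : S ∈ centers F n ℓ ↔ ∀ i, (S i).card = ℓ := by
  simp [centers, Fintype.mem_piFinset, Finset.mem_powersetCard]

theorem card_centers (ℓ : ℕ) : (centers F n ℓ).card = ((Fintype.card F).choose ℓ) ^ n := by
  simp [centers]

theorem mem_ball {ρ : ℝ} {S : Fin n → Finset F} {x : Fin n → F} :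
    x ∈ ball ρ S ↔ relDist x S ≤ ρ := by
  simp [ball]

open Classical in
theorem relDist_le_iff {F : Type*} {ρ : ℝ} (hρ : 0 ≤ ρ) {S : Fin n → Finset F} {x : Fin n → F} :
    relDist x S ≤ ρ ↔ ((Finset.univ.filter fun i => x i ∉ S i).card : ℝ) ≤ ρ * n := by
  rcases n.eq_zero_or_pos with rfl | hn
  · simp [relDist, hρ]
  · rw [relDist, div_le_iff₀ (by exact_mod_cast hn)]

theorem ball_mono {ρ : ℝ} (hρ : 0 ≤ ρ) {S S' : Fin n → Finset F} (h : ∀ i, S i ⊆ S' i) :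
    ball ρ S ⊆ ball ρ S' := by
  intro x hx
  rw [mem_ball, relDist_le_iff hρ] at hx ⊢
  refine le_trans ?_ hx
  gcongr with i
  exact h i

-- Expand `(s + (1 - s) 1_A) (s + (1 - s) 1_B)`. Only the last term depends on how `A` and `B` meet,
-- and distinct sets of equal size `ℓ` share at most `ℓ - 1` points.
open Classical in
theorem sum_ite_mul_ite_le {A B : Finset F} {ℓ : ℕ} (hA : A.card = ℓ) (hB : B.card = ℓ) (s : ℝ) :
    ∑ a : F, (if a ∈ A then 1 else s) * (if a ∈ B then 1 else s) ≤
      ℓ + (Fintype.card F - ℓ) * s ^ 2 - if A = B then 0 else (1 - s) ^ 2 := by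
  have h1 : ∀ a : F, (if a ∈ A then 1 else s) * (if a ∈ B then 1 else s) =
      s ^ 2 + s * (1 - s) * (if a ∈ A then 1 else 0) + s * (1 - s) * (if a ∈ B then 1 else 0) +
        (1 - s) ^ 2 * (if a ∈ A ∩ B then 1 else 0) := by
    intro a
    by_cases ha : a ∈ A <;> by_cases hb : a ∈ B <;> simp [ha, hb] <;> ring
  have h2 : ∑ a : F, (if a ∈ A then 1 else s) * (if a ∈ B then 1 else s) =
      Fintype.card F * s ^ 2 + 2 * ℓ * s * (1 - s) + (1 - s) ^ 2 * (A ∩ B).card := by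
    simp_rw [h1, Finset.sum_add_distrib, ← Finset.mul_sum, Finset.sum_ite_mem, Finset.univ_inter]
    simp [hA, hB]
    ring
  rw [h2]
  split_ifs with h
  · subst h
    rw [Finset.inter_self, hA]
    apply le_of_eq
    ring
  · have hlt : (A ∩ B).card + 1 ≤ ℓ := by
      rw [← hA, Nat.succ_le_iff]
      refine Finset.card_lt_card (Finset.inter_subset_left.ssubset_of_ne fun h' => h ?_)
      exact Finset.eq_of_subset_of_card_le (Finset.inter_eq_left.mp h') (hB.trans hA.symm).le
    have hlt' : ((A ∩ B).card : ℝ) + 1 ≤ ℓ := by exact_mod_cast hlt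
    nlinarith [mul_le_mul_of_nonneg_left hlt' (sq_nonneg (1 - s))]

open Classical in
theorem prod_ite_mem_eq_pow {F : Type*} (x : Fin n → F) (S : Fin n → Finset F) (s : ℝ) :
    ∏ i, (if x i ∈ S i then 1 else s) = s ^ (Finset.univ.filter fun i => x i ∉ S i).card := by
  rw [Finset.prod_ite]
  simp

/-! ### Upper bounds for balls and their intersections -/

section Card

variable {q ℓ : ℕ} {ρ : ℝ} (hq : Fintype.card F = q)
  (hℓ : 1 ≤ ℓ) (hρ : 0 < ρ) (hρ1 : ρ < 1) (hℓq : (ℓ : ℝ) < q) (hρq : ρ * q < q - ℓ)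
include hq hℓ hρ hρ1 hℓq hρq

-- Exponential weights: charge a factor `s = √t` for each coordinate of `x` outside `S i`, and again
-- for each outside `S' i`. A point of both balls has weight at least `s ^ (2 ρ n) = t ^ (ρ n)`,
-- while the total weight of all vectors is a product over coordinates. Coordinates with `S i ≠ S'
-- i` lose `(1 - s) ^ 2`, which `decay` expresses relative to `ℓ / (1 - ρ)`.
open Classical in
theorem card_ball_inter_ball_le {S S' : Fin n → Finset F} (hS : S ∈ centers F n ℓ)
    (hS' : S' ∈ centers F n ℓ) :
    ((ball ρ S ∩ ball ρ S').card : ℝ) ≤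
      growth q ℓ ρ ^ n * ∏ i, (if S i = S' i then 1 else decay q ℓ ρ) := by
  rw [mem_centers] at hS hS'
  set t := tilt q ℓ ρ with ht
  have htpos : 0 < t := tilt_pos hℓ hρ hρ1 hℓq
  have htlt : t < 1 := tilt_lt_one hρ1 hℓq hρq
  set s := √t with hs
  have hspos : 0 < s := Real.sqrt_pos.mpr htpos
  have hst : s ^ 2 = t := Real.sq_sqrt htpos.le
  have hW := weight_eq (q := q) hℓ hρ1 hℓq
  have hℓ0 : (1 : ℝ) ≤ ℓ := by exact_mod_cast hℓ
  have h1ρ : 0 < 1 - ρ := by linarith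
  have key : ((ball ρ S ∩ ball ρ S').card : ℝ) * (t ^ ρ) ^ n ≤
      ∑ x : Fin n → F, ∏ i, ((if x i ∈ S i then 1 else s) * (if x i ∈ S' i then 1 else s)) := by
    rw [← nsmul_eq_mul]
    refine (Finset.card_nsmul_le_sum _ _ _ fun x hx => ?_).trans
      (Finset.sum_le_univ_sum_of_nonneg fun x => Finset.prod_nonneg fun i _ => by positivity)
    rw [Finset.mem_inter, mem_ball, mem_ball, relDist_le_iff hρ.le, relDist_le_iff hρ.le] at hx
    rw [Finset.prod_mul_distrib, prod_ite_mem_eq_pow, prod_ite_mem_eq_pow, ← pow_add,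
      ← Real.rpow_natCast, ← Real.rpow_natCast, ← Real.rpow_mul htpos.le, ← hst,
      ← Real.rpow_natCast s 2, ← Real.rpow_mul hspos.le]
    refine Real.rpow_le_rpow_of_exponent_ge hspos ?_ ?_
    · rw [hs, Real.sqrt_le_one]
      exact htlt.le
    · push_cast
      linarith [hx.1, hx.2]
  have hcoord : ∑ x : Fin n → F, ∏ i, ((if x i ∈ S i then 1 else s) * (if x i ∈ S' i then 1 else s))
      ≤ ∏ i : Fin n, (ℓ / (1 - ρ) * (if S i = S' i then 1 else decay q ℓ ρ)) := by
    have h1 := Finset.prod_univ_sum (fun _ : Fin n => (Finset.univ : Finset F))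
      (fun i a => (if a ∈ S i then 1 else s) * (if a ∈ S' i then 1 else s))
    rw [Fintype.piFinset_univ] at h1
    rw [← h1]
    refine Finset.prod_le_prod (fun i _ => Finset.sum_nonneg fun a _ => by positivity) fun i _ => ?_
    refine (sum_ite_mul_ite_le (hS i) (hS' i) s).trans (le_of_eq ?_)
    rw [hq, hst, hW]
    split_ifs
    · ring
    · rw [decay, ← ht, ← hs]
      field_simp
  have h2 := key.trans hcoord
  rw [Finset.prod_mul_distrib, Finset.prod_const, Finset.card_univ, Fintype.card_fin] at h2
  rw [growth_eq hℓ hρ hρ1 hℓq, ← ht, Real.rpow_neg htpos.le, inv_mul_eq_div, div_pow,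
    div_mul_eq_mul_div, le_div_iff₀ (by positivity)]
  exact h2

theorem card_ball_le {S : Fin n → Finset F} (hS : S ∈ centers F n ℓ) :
    ((ball ρ S).card : ℝ) ≤ growth q ℓ ρ ^ n := by
  classical
  simpa using card_ball_inter_ball_le hq hℓ hρ hρ1 hℓq hρq hS hS

-- The intersection bound is a product over coordinates, so the sum over `S'` factorizes. In each
-- coordinate one choice agrees with `S` and the other `q.choose ℓ - 1` each contribute `γ ^ j`.
open Classical in
theorem sum_card_ball_inter_ball_pow_le (j : ℕ) :
    ∑ S ∈ centers F n ℓ, ∑ S' ∈ centers F n ℓ, ((ball ρ S ∩ ball ρ S').card : ℝ) ^ j ≤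
      (growth q ℓ ρ ^ j * (q.choose ℓ * (1 + (q.choose ℓ - 1) * decay q ℓ ρ ^ j))) ^ n := by
  set γ := decay q ℓ ρ with hγ
  have hγpos : 0 < γ := decay_pos hℓ hρ hρ1 hℓq hρq
  have hV : 0 < growth q ℓ ρ := one_pos.trans (one_lt_growth hℓ hρ hρ1 hℓq hρq)
  set P := Finset.powersetCard ℓ (Finset.univ : Finset F) with hP
  have hPcard : P.card = q.choose ℓ := by simp [hP, hq]
  have hinner : ∀ A ∈ P, ∑ B ∈ P, (if A = B then 1 else γ ^ j) =
      1 + ((q.choose ℓ : ℝ) - 1) * γ ^ j := by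
    intro A hA
    have : ∀ B, (if A = B then 1 else γ ^ j) = γ ^ j + if A = B then 1 - γ ^ j else 0 := by
      intro B
      split_ifs <;> ring
    simp_rw [this, Finset.sum_add_distrib, Finset.sum_ite_eq, if_pos hA, Finset.sum_const,
      hPcard, nsmul_eq_mul]
    ring
  calc ∑ S ∈ centers F n ℓ, ∑ S' ∈ centers F n ℓ, ((ball ρ S ∩ ball ρ S').card : ℝ) ^ j
      ≤ ∑ S ∈ centers F n ℓ, ∑ S' ∈ centers F n ℓ,
          (growth q ℓ ρ ^ n) ^ j * ∏ i, (if S i = S' i then 1 else γ ^ j) := by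
        refine Finset.sum_le_sum fun S hS => Finset.sum_le_sum fun S' hS' => ?_
        refine (pow_le_pow_left₀ (Nat.cast_nonneg _)
          (card_ball_inter_ball_le hq hℓ hρ hρ1 hℓq hρq hS hS') j).trans (le_of_eq ?_)
        rw [mul_pow, ← Finset.prod_pow]
        congr 1
        exact Finset.prod_congr rfl fun i _ => by split_ifs; exacts [one_pow j, rfl]
    _ = (growth q ℓ ρ ^ n) ^ j *
          ∑ S ∈ centers F n ℓ, ∏ i, ∑ B ∈ P, (if S i = B then 1 else γ ^ j) := by
        simp_rw [← Finset.mul_sum]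
        congr 1
        refine Finset.sum_congr rfl fun S _ => ?_
        rw [Finset.prod_univ_sum]
        rfl
    _ = (growth q ℓ ρ ^ n) ^ j *
          ∑ S ∈ centers F n ℓ, (1 + ((q.choose ℓ : ℝ) - 1) * γ ^ j) ^ n := by
        congr 1
        refine Finset.sum_congr rfl fun S hS => ?_
        rw [Finset.prod_congr rfl fun i _ => hinner (S i) ?_, Finset.prod_const, Finset.card_univ,
          Fintype.card_fin]
        simpa [hP, Finset.mem_powersetCard] using mem_centers.mp hS i
    _ = _ := by
        rw [Finset.sum_const, card_centers, hq, nsmul_eq_mul]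
        push_cast
        rw [mul_pow, mul_pow, ← pow_mul, ← pow_mul, mul_comm n j]

end Card

/-! ### Lower bound for the size of a ball -/

/-- The term of a binomial distribution at its rounded-down mean is at least inverse linear. -/
theorem one_sub_div_le_choose_mul_pow_mul_pow {ρ : ℝ} (hρ : 0 < ρ) (hρ1 : ρ < 1) (n : ℕ) :
    (1 - ρ) / (n + 1) ≤
      n.choose ⌊ρ * n⌋₊ * ρ ^ ⌊ρ * n⌋₊ * (1 - ρ) ^ (n - ⌊ρ * n⌋₊) := by
  set a : ℕ → ℝ := fun k => n.choose k * ρ ^ k * (1 - ρ) ^ (n - k) with ha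
  set m := ⌊ρ * n⌋₊ with hm
  have h1ρ : 0 < 1 - ρ := by linarith
  have ha0 : ∀ k, 0 ≤ a k := fun k => by positivity
  have hmle : (m : ℝ) ≤ ρ * n := Nat.floor_le (by positivity)
  have hltm : ρ * n < m + 1 := Nat.lt_floor_add_one _
  have hrec : ∀ k, k < n → (k + 1) * (1 - ρ) * a (k + 1) = (n - k) * ρ * a k := by
    intro k hk
    have hc : (n.choose (k + 1) : ℝ) * (k + 1) = n.choose k * (n - k) := by
      rw [← Nat.cast_sub hk.le]
      exact_mod_cast Nat.choose_succ_right_eq n k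
    have hp : (1 - ρ) ^ (n - k) = (1 - ρ) ^ (n - (k + 1)) * (1 - ρ) := by
      rw [← pow_succ]
      congr 1
      omega
    simp only [ha]
    rw [hp, pow_succ]
    linear_combination ρ ^ k * ρ * (1 - ρ) ^ (n - (k + 1)) * (1 - ρ) * hc
  have hzero : ∀ k, n ≤ k → a (k + 1) = 0 := fun k hk => by
    simp [ha, Nat.choose_eq_zero_of_lt (Nat.lt_succ_of_le hk)]
  have hup : ∀ k, k + 1 ≤ m → a k ≤ a (k + 1) := by
    intro k hk
    have hk' : (k : ℝ) + 1 ≤ m := by exact_mod_cast hk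
    have hkn : k < n := by
      have : (k : ℝ) < n := by nlinarith [Nat.cast_nonneg (α := ℝ) n]
      exact_mod_cast this
    have h := hrec k hkn
    have hpos : 0 < ((k : ℝ) + 1) * (1 - ρ) := by positivity
    refine le_of_mul_le_mul_left ?_ hpos
    rw [h]
    exact mul_le_mul_of_nonneg_right (by nlinarith) (ha0 k)
  have hdown : ∀ k, m + 1 ≤ k → a (k + 1) ≤ a k := by
    intro k hk
    rcases lt_or_ge k n with hkn | hkn
    · have hk' : (m : ℝ) + 1 ≤ k := by exact_mod_cast hk
      have h := hrec k hkn
      have hpos : 0 < ((k : ℝ) + 1) * (1 - ρ) := by positivity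
      refine le_of_mul_le_mul_left ?_ hpos
      rw [h]
      exact mul_le_mul_of_nonneg_right (by nlinarith) (ha0 k)
    · rw [hzero k hkn]
      exact ha0 k
  -- The mode may be `m + 1` instead of `m`; allowing for this costs the factor `1 - ρ`.
  have hmid : (1 - ρ) * a (m + 1) ≤ a m := by
    rcases lt_or_ge m n with hmn | hmn
    · have h := hrec m hmn
      have hpos : (0 : ℝ) < m + 1 := by positivity
      refine le_of_mul_le_mul_left ?_ hpos
      rw [← mul_assoc, h]
      exact mul_le_mul_of_nonneg_right (by nlinarith [Nat.cast_nonneg (α := ℝ) m]) (ha0 m)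
    · rw [hzero m hmn, mul_zero]
      exact ha0 m
  have hmono : ∀ d, d ≤ m → a (m - d) ≤ a m := by
    intro d
    induction d with
    | zero => simp
    | succ d ih =>
      intro hd
      have h := hup (m - (d + 1)) (by omega)
      rw [show m - (d + 1) + 1 = m - d by omega] at h
      exact h.trans (ih (by omega))
  have hanti : ∀ d, a (m + 1 + d) ≤ a (m + 1) := by
    intro d
    induction d with
    | zero => simp
    | succ d ih => exact (hdown (m + 1 + d) (by omega)).trans ih
  have hall : ∀ k, (1 - ρ) * a k ≤ a m := by
    intro k
    rcases le_or_gt k m with hk | hk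
    · have h := hmono (m - k) (by omega)
      rw [show m - (m - k) = k by omega] at h
      nlinarith [ha0 k]
    · obtain ⟨d, rfl⟩ := Nat.exists_eq_add_of_le (Nat.succ_le_of_lt hk)
      exact (mul_le_mul_of_nonneg_left (hanti d) h1ρ.le).trans hmid
  have hsum : ∑ k ∈ Finset.range (n + 1), a k = 1 := by
    have h := add_pow ρ (1 - ρ) n
    rw [add_sub_cancel, one_pow] at h
    rw [h]
    exact Finset.sum_congr rfl fun k _ => by simp only [ha]; ring
  rw [div_le_iff₀ (by positivity)]
  calc 1 - ρ = ∑ k ∈ Finset.range (n + 1), (1 - ρ) * a k := by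
        rw [← Finset.mul_sum, hsum, mul_one]
    _ ≤ ∑ k ∈ Finset.range (n + 1), a m := Finset.sum_le_sum fun k _ => hall k
    _ = a m * (n + 1) := by
        rw [Finset.sum_const, Finset.card_range, nsmul_eq_mul]
        push_cast
        ring

variable {F : Type*} [Fintype F] {n : ℕ}

/-- The number of vectors with exactly `k` coordinates outside the centre. -/
theorem choose_mul_pow_mul_pow_le_card_ball {ρ : ℝ} (hρ : 0 ≤ ρ) {ℓ k : ℕ} (hk : (k : ℝ) ≤ ρ * n)
    {S : Fin n → Finset F} (hS : S ∈ centers F n ℓ) :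
    n.choose k * (Fintype.card F - ℓ) ^ k * ℓ ^ (n - k) ≤ (ball ρ S).card := by
  classical
  rw [mem_centers] at hS
  -- The vectors whose set of coordinates outside the centre is exactly `A`; these classes are
  -- disjoint for distinct `A`.
  set B : Finset (Fin n) → Finset (Fin n → F) := fun A =>
    Fintype.piFinset fun i => if i ∈ A then (S i)ᶜ else S i with hB
  have hmem : ∀ A x, x ∈ B A → (Finset.univ.filter fun i => x i ∉ S i) = A := by
    intro A x hx
    ext i
    have h := Fintype.mem_piFinset.mp hx i
    by_cases hi : i ∈ A <;> simp_all
  have hcard : ∀ A ∈ Finset.powersetCard k (Finset.univ : Finset (Fin n)),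
      (B A).card = (Fintype.card F - ℓ) ^ k * ℓ ^ (n - k) := by
    intro A hA
    have hA' := (Finset.mem_powersetCard.mp hA).2
    rw [hB, Fintype.card_piFinset]
    have : ∀ i, (if i ∈ A then (S i)ᶜ else S i).card =
        if i ∈ A then Fintype.card F - ℓ else ℓ := by
      intro i
      split_ifs
      · rw [Finset.card_compl, hS]
      · exact hS i
    simp_rw [this, Finset.prod_ite, Finset.prod_const]
    congr 2
    · simp [hA']
    · rw [Finset.filter_not, Finset.card_sdiff_of_subset (Finset.filter_subset _ _)]
      simp [hA']
  calc n.choose k * (Fintype.card F - ℓ) ^ k * ℓ ^ (n - k)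
      = ∑ A ∈ Finset.powersetCard k (Finset.univ : Finset (Fin n)), (B A).card := by
        rw [Finset.sum_congr rfl hcard, Finset.sum_const, Finset.card_powersetCard,
          Finset.card_univ, Fintype.card_fin, smul_eq_mul, mul_assoc]
    _ = ((Finset.powersetCard k Finset.univ).biUnion B).card := by
        rw [Finset.card_biUnion]
        intro A _ A' _ hne
        refine Finset.disjoint_left.mpr fun x hx hx' => hne ?_
        rw [← hmem A x hx, hmem A' x hx']
    _ ≤ (ball ρ S).card := by
        refine Finset.card_le_card fun x hx => ?_
        obtain ⟨A, hA, hx⟩ := Finset.mem_biUnion.mp hx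
        rw [mem_ball, relDist_le_iff hρ]
        have := hmem A x hx
        rw [(Finset.mem_powersetCard.mp hA).2.symm, ← this] at hk
        convert hk

/-- The vectors at distance exactly `k = ⌊ρ n⌋` already suffice. Their number is a binomial
probability times `(ℓ / (1 - ρ)) ^ n * t⁻¹ ^ k`; the former costs `(1 - ρ) / (n + 1)`, and rounding
`ρ n` down to `k` costs at most `t`. -/
theorem growth_pow_mul_le_card_ball {q ℓ : ℕ} {ρ : ℝ} (hq : Fintype.card F = q)
    (hℓ : 1 ≤ ℓ) (hρ : 0 < ρ) (hρ1 : ρ < 1) (hℓq : (ℓ : ℝ) < q) (hρq : ρ * q < q - ℓ)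
    {S : Fin n → Finset F} (hS : S ∈ centers F n ℓ) :
    growth q ℓ ρ ^ n * ((1 - ρ) * tilt q ℓ ρ / (n + 1)) ≤ (ball ρ S).card := by
  set k := ⌊ρ * n⌋₊ with hk
  set t := tilt q ℓ ρ with ht
  have hkle : (k : ℝ) ≤ ρ * n := Nat.floor_le (by positivity)
  have hltk : ρ * n < k + 1 := Nat.lt_floor_add_one _
  have htpos : 0 < t := tilt_pos hℓ hρ hρ1 hℓq
  have htlt : t < 1 := tilt_lt_one hρ1 hℓq hρq
  have h1ρ : 0 < 1 - ρ := by linarith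
  have hℓ0 : (1 : ℝ) ≤ ℓ := by exact_mod_cast hℓ
  have hkn : k ≤ n := by
    have : (k : ℝ) ≤ n := by nlinarith [Nat.cast_nonneg (α := ℝ) n]
    exact_mod_cast this
  have hℓq' : ℓ ≤ q := by exact_mod_cast hℓq.le
  have hcount : (n.choose k * ((q : ℝ) - ℓ) ^ k * ℓ ^ (n - k)) ≤ (ball ρ S).card := by
    have h := choose_mul_pow_mul_pow_le_card_ball hρ.le hkle hS
    rw [hq] at h
    rw [← Nat.cast_sub hℓq']
    exact_mod_cast h
  have hsub : (q : ℝ) - ℓ = ℓ / (1 - ρ) / t * ρ := by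
    have h3 : (q : ℝ) - ℓ ≠ 0 := by linarith
    rw [ht, tilt]
    field_simp
  have hℓeq : (ℓ : ℝ) = ℓ / (1 - ρ) * (1 - ρ) := by field_simp
  have hterm : (n.choose k * ((q : ℝ) - ℓ) ^ k * ℓ ^ (n - k)) =
      (n.choose k * ρ ^ k * (1 - ρ) ^ (n - k)) * ((ℓ / (1 - ρ)) ^ n * t⁻¹ ^ k) := by
    conv_lhs => rw [hsub, hℓeq]
    have : ((ℓ : ℝ) / (1 - ρ)) ^ n = (ℓ / (1 - ρ)) ^ k * (ℓ / (1 - ρ)) ^ (n - k) := by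
      rw [← pow_add]
      congr 1
      omega
    rw [this]
    have hcancel : (ℓ : ℝ) / (1 - ρ) * (1 - ρ) / (1 - ρ) = ℓ / (1 - ρ) := by field_simp
    simp only [hcancel, div_eq_mul_inv _ t, mul_pow]
    ring
  have hpow : (t ^ (-ρ)) ^ n * t ≤ t⁻¹ ^ k := by
    rw [← Real.rpow_natCast, ← Real.rpow_mul htpos.le, ← Real.rpow_natCast t⁻¹,
      Real.inv_rpow htpos.le, ← Real.rpow_neg htpos.le]
    nth_rewrite 2 [← Real.rpow_one t]
    rw [← Real.rpow_add htpos]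
    exact Real.rpow_le_rpow_of_exponent_ge htpos htlt.le (by linarith)
  refine le_trans ?_ hcount
  rw [hterm, growth_eq hℓ hρ hρ1 hℓq, ← ht]
  calc (t ^ (-ρ) * (ℓ / (1 - ρ))) ^ n * ((1 - ρ) * t / (n + 1))
      = (1 - ρ) / (n + 1) * ((ℓ / (1 - ρ)) ^ n * ((t ^ (-ρ)) ^ n * t)) := by
        rw [mul_pow]
        ring
    _ ≤ _ := by
        gcongr
        exact one_sub_div_le_choose_mul_pow_mul_pow hρ hρ1 n

/-! ### First and second moment of the number of lists -/

/-- A pair is determined by its intersection, which lies in `B ∩ B'`, and its two differences. -/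
theorem card_filter_card_inter_eq_le {α : Type*} [DecidableEq α] (B B' : Finset α) (L j : ℕ) :
    ((B.powersetCard L ×ˢ B'.powersetCard L).filter fun x => (x.1 ∩ x.2).card = j).card ≤
      (B ∩ B').card ^ j * (B.card ^ (L - j) * B'.card ^ (L - j)) := by
  calc _ ≤ ((B ∩ B').powersetCard j ×ˢ
        (B.powersetCard (L - j) ×ˢ B'.powersetCard (L - j))).card := by
        refine Finset.card_le_card_of_injOn (fun x => (x.1 ∩ x.2, x.1 \ x.2, x.2 \ x.1)) ?_ ?_
        · rintro ⟨T, T'⟩ h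
          simp only [Finset.coe_filter, Finset.mem_product, Finset.mem_powersetCard,
            Set.mem_ofPred_eq] at h
          obtain ⟨⟨⟨hT, hTc⟩, hT', hTc'⟩, hj⟩ := h
          simp only [Finset.coe_product, Set.mem_prod, Finset.mem_coe, Finset.mem_powersetCard]
          refine ⟨⟨Finset.inter_subset_inter hT hT', hj⟩,
            ⟨Finset.sdiff_subset.trans hT, ?_⟩, Finset.sdiff_subset.trans hT', ?_⟩
          · rw [Finset.card_sdiff, Finset.inter_comm, hTc, hj]
          · rw [Finset.card_sdiff, hTc', hj]
        · rintro ⟨T, T'⟩ _ ⟨U, U'⟩ _ h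
          simp only [Prod.mk.injEq] at h
          obtain ⟨h1, h2, h3⟩ := h
          refine Prod.ext ?_ ?_
          · simp only
            rw [← Finset.sdiff_union_inter T T', h1, h2, Finset.sdiff_union_inter]
          · simp only
            rw [← Finset.sdiff_union_inter T' T, Finset.inter_comm, h1, h3, Finset.inter_comm,
              Finset.sdiff_union_inter]
    _ ≤ _ := by
        rw [Finset.card_product, Finset.card_product, Finset.card_powersetCard,
          Finset.card_powersetCard, Finset.card_powersetCard]
        gcongr <;> exact Nat.choose_le_pow _ _

/-- Disjoint lists are uncorrelated, so the sum over the intersection size starts at `j = 1`. In the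
other terms the product of the means is dropped. -/
theorem sum_sum_pow_card_union_sub_le {α : Type*} [DecidableEq α] (B B' : Finset α) (L : ℕ)
    {p M : ℝ} (hp : 0 ≤ p) (hB : (B.card : ℝ) ≤ M) (hB' : (B'.card : ℝ) ≤ M) :
    ∑ T ∈ B.powersetCard L, ∑ T' ∈ B'.powersetCard L, (p ^ (T ∪ T').card - p ^ L * p ^ L) ≤
      ∑ j ∈ Finset.Icc 1 L, ((B ∩ B').card : ℝ) ^ j * (M ^ (L - j) * M ^ (L - j)) *
        p ^ (2 * L - j) := by
  have hM : 0 ≤ M := (Nat.cast_nonneg _).trans hB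
  rw [← Finset.sum_product']
  calc _ ≤ ∑ x ∈ B.powersetCard L ×ˢ B'.powersetCard L, ∑ j ∈ Finset.Icc 1 L,
        (if (x.1 ∩ x.2).card = j then p ^ (2 * L - j) else 0) := by
        refine Finset.sum_le_sum fun x hx => ?_
        simp only [Finset.mem_product, Finset.mem_powersetCard] at hx
        obtain ⟨⟨_, h1⟩, _, h2⟩ := hx
        have hadd := Finset.card_union_add_card_inter x.1 x.2
        have hle : (x.1 ∩ x.2).card ≤ L := h1 ▸ Finset.card_le_card Finset.inter_subset_left
        rw [Finset.sum_ite_eq]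
        split_ifs with h
        · rw [show (x.1 ∪ x.2).card = 2 * L - (x.1 ∩ x.2).card by omega]
          exact sub_le_self _ (by positivity)
        · rw [Finset.mem_Icc] at h
          rw [show (x.1 ∪ x.2).card = L + L by omega, pow_add, sub_self]
    _ = ∑ j ∈ Finset.Icc 1 L, (((B.powersetCard L ×ˢ B'.powersetCard L).filter
          fun x => (x.1 ∩ x.2).card = j).card : ℝ) * p ^ (2 * L - j) := by
        rw [Finset.sum_comm]
        refine Finset.sum_congr rfl fun j _ => ?_
        rw [← Finset.sum_filter, Finset.sum_const, nsmul_eq_mul]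
    _ ≤ _ := by
        refine Finset.sum_le_sum fun j _ => ?_
        refine mul_le_mul_of_nonneg_right ?_ (by positivity)
        calc _ ≤ (((B ∩ B').card ^ j * (B.card ^ (L - j) * B'.card ^ (L - j)) : ℕ) : ℝ) := by
              exact_mod_cast card_filter_card_inter_eq_le B B' L j
          _ ≤ _ := by
              push_cast
              gcongr

theorem IsListRecoverable.mono {F : Type*} {n : ℕ} {ρ : ℝ} {ℓ L L' : ℕ} {C : Set (Fin n → F)}
    (h : IsListRecoverable ρ ℓ L C) (hL : L ≤ L') : IsListRecoverable ρ ℓ L' C :=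
  fun S hS => (h S hS).trans_le hL

variable {F : Type*} [Fintype F] {n : ℕ}

/-- Enlarging the sets only enlarges the ball, so centres with exactly `ℓ` symbols suffice. This
turns failure into a finite union of inclusion events. -/
theorem not_isListRecoverable_iff {ρ : ℝ} (hρ : 0 ≤ ρ) {ℓ L : ℕ} (hℓ : ℓ ≤ Fintype.card F)
    {C : Set (Fin n → F)} :
    ¬ IsListRecoverable ρ ℓ L C ↔
      ∃ S ∈ centers F n ℓ, ∃ T ∈ (ball ρ S).powersetCard L, (T : Set (Fin n → F)) ⊆ C := by
  classical
  unfold IsListRecoverable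
  push Not
  constructor
  · rintro ⟨S, hS, hL⟩
    choose S' hsub hS' using fun i =>
      Finset.exists_superset_card_eq (hS i) hℓ
    refine ⟨S', mem_centers.mpr hS', ?_⟩
    have hfin : {c ∈ C | relDist c S ≤ ρ}.Finite := Set.toFinite _
    rw [Set.ncard_eq_toFinset_card _ hfin] at hL
    obtain ⟨T, hT, hTc⟩ := Finset.exists_subset_card_eq hL
    have hT' : ∀ x ∈ T, x ∈ C ∧ relDist x S ≤ ρ := fun x hx => by simpa using hT hx
    refine ⟨T, Finset.mem_powersetCard.mpr ⟨fun x hx => ?_, hTc⟩, fun x hx => (hT' x hx).1⟩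
    exact ball_mono hρ hsub (mem_ball.mpr (hT' x hx).2)
  · rintro ⟨S, hS, T, hT, hTC⟩
    obtain ⟨hTB, hTc⟩ := Finset.mem_powersetCard.mp hT
    refine ⟨S, fun i => (mem_centers.mp hS i).le, ?_⟩
    rw [← hTc, ← Set.ncard_coe_finset]
    exact Set.ncard_le_ncard (fun x hx => ⟨hTC hx, mem_ball.mp (hTB hx)⟩) (Set.toFinite _)

theorem randomCode_real_superset (R : ℝ) (T : Finset (Fin n → F)) :
    (randomCode F n R).real {C | (T : Set (Fin n → F)) ⊆ C} =
      (inclusionProb (Fintype.card F) n R : ℝ) ^ T.card :=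
  setBernoulli_real_superset _ T

/-- The union bound over all lists of size `L` in a ball. -/
theorem randomCode_real_not_isListRecoverable_le {ρ : ℝ} (hρ : 0 ≤ ρ) {ℓ : ℕ} (L : ℕ)
    (hℓ : ℓ ≤ Fintype.card F) (R : ℝ) {M : ℝ}
    (hM : ∀ S ∈ centers F n ℓ, ((ball ρ S).card : ℝ) ≤ M) :
    (randomCode F n R).real {C | ¬ IsListRecoverable ρ ℓ L C} ≤
      ((Fintype.card F).choose ℓ : ℝ) ^ n *
        (M * (inclusionProb (Fintype.card F) n R : ℝ)) ^ L := by
  set p : ℝ := (inclusionProb (Fintype.card F) n R : ℝ)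
  have hp : 0 ≤ p := (inclusionProb (Fintype.card F) n R).2.1
  have hset : {C : Set (Fin n → F) | ¬ IsListRecoverable ρ ℓ L C} =
      ⋃ S ∈ centers F n ℓ, ⋃ T ∈ (ball ρ S).powersetCard L, {C | (T : Set (Fin n → F)) ⊆ C} := by
    ext C
    simp only [Set.mem_ofPred_eq, not_isListRecoverable_iff hρ hℓ, Set.mem_iUnion, exists_prop]
  rw [hset]
  calc _ ≤ ∑ S ∈ centers F n ℓ, ∑ T ∈ (ball ρ S).powersetCard L, p ^ L := by
        refine (measureReal_biUnion_finset_le _ _).trans (Finset.sum_le_sum fun S _ => ?_)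
        refine (measureReal_biUnion_finset_le _ _).trans (Finset.sum_le_sum fun T hT => ?_)
        rw [randomCode_real_superset, (Finset.mem_powersetCard.mp hT).2]
    _ ≤ ∑ S ∈ centers F n ℓ, (M * p) ^ L := by
        refine Finset.sum_le_sum fun S hS => ?_
        rw [Finset.sum_const, Finset.card_powersetCard, nsmul_eq_mul, mul_pow]
        refine mul_le_mul_of_nonneg_right ?_ (by positivity)
        calc (((ball ρ S).card.choose L : ℕ) : ℝ) ≤ ((ball ρ S).card : ℝ) ^ L := by
              exact_mod_cast Nat.choose_le_pow _ _
          _ ≤ M ^ L := by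
              have := hM S hS
              gcongr
    _ = _ := by
        rw [Finset.sum_const, card_centers, nsmul_eq_mul]
        push_cast
        rfl

open Classical in
/-- The second moment bound for the number of lists of size `L` in a ball. -/
theorem randomCode_real_isListRecoverable_mul_sq_le {ρ : ℝ} (hρ : 0 ≤ ρ) {ℓ : ℕ} (L : ℕ)
    (hℓ : ℓ ≤ Fintype.card F) (R : ℝ) {M p : ℝ} (hp : p = inclusionProb (Fintype.card F) n R)
    (hM : ∀ S ∈ centers F n ℓ, ((ball ρ S).card : ℝ) ≤ M) :
    (randomCode F n R).real {C | IsListRecoverable ρ ℓ L C} *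
        (∑ S ∈ centers F n ℓ, ((ball ρ S).card.choose L : ℝ) * p ^ L) ^ 2 ≤
      ∑ j ∈ Finset.Icc 1 L, (∑ S ∈ centers F n ℓ, ∑ S' ∈ centers F n ℓ,
        ((ball ρ S ∩ ball ρ S').card : ℝ) ^ j) * (M ^ (L - j) * M ^ (L - j)) * p ^ (2 * L - j) := by
  have hp0 : 0 ≤ p := hp ▸ (inclusionProb (Fintype.card F) n R).2.1
  set s := (centers F n ℓ).sigma fun S => (ball ρ S).powersetCard L with hs
  set A : (Σ _ : Fin n → Finset F, Finset (Fin n → F)) → Set (Set (Fin n → F)) :=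
    fun x => {C | (x.2 : Set (Fin n → F)) ⊆ C} with hA
  have hprob : ∀ x, (randomCode F n R).real (A x) = p ^ x.2.card := fun x => by
    rw [hA, randomCode_real_superset, hp]
  have hinter : ∀ x y, (randomCode F n R).real (A x ∩ A y) = p ^ (x.2 ∪ y.2).card := by
    intro x y
    rw [hp, ← randomCode_real_superset]
    congr 1
    ext C
    simp [hA, Set.union_subset_iff]
  have hset : {C : Set (Fin n → F) | IsListRecoverable ρ ℓ L C} = {C | ∀ x ∈ s, C ∉ A x} := by
    ext C
    rw [Set.mem_ofPred_eq, ← not_not (a := IsListRecoverable ρ ℓ L C),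
      not_isListRecoverable_iff hρ hℓ]
    simp only [hs, hA, Set.mem_ofPred_eq, Sigma.forall, Finset.mem_sigma]
    push Not
    exact ⟨fun h S T hST => h S hST.1 T hST.2, fun h S hS T hT => h S T ⟨hS, hT⟩⟩
  have hsum : ∑ x ∈ s, (randomCode F n R).real (A x) =
      ∑ S ∈ centers F n ℓ, ((ball ρ S).card.choose L : ℝ) * p ^ L := by
    simp_rw [hprob]
    rw [hs, Finset.sum_sigma]
    refine Finset.sum_congr rfl fun S _ => ?_
    rw [Finset.sum_congr rfl fun T hT => by rw [(Finset.mem_powersetCard.mp hT).2],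
      Finset.sum_const, Finset.card_powersetCard, nsmul_eq_mul]
  have h := measureReal_forall_notMem_mul_sq_le (randomCode F n R) s A
    fun _ => measurableSet_of_finite_pi _
  rw [← hset, hsum] at h
  refine h.trans ?_
  simp_rw [hprob, hinter]
  rw [hs, Finset.sum_sigma]
  calc _ = ∑ S ∈ centers F n ℓ, ∑ S' ∈ centers F n ℓ, ∑ T ∈ (ball ρ S).powersetCard L,
        ∑ T' ∈ (ball ρ S').powersetCard L, (p ^ (T ∪ T').card - p ^ L * p ^ L) := by
        refine Finset.sum_congr rfl fun S _ => ?_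
        refine Eq.trans (Finset.sum_congr rfl fun T hT => ?_) Finset.sum_comm
        rw [Finset.sum_sigma]
        refine Finset.sum_congr rfl fun S' _ => Finset.sum_congr rfl fun T' hT' => ?_
        rw [(Finset.mem_powersetCard.mp hT).2, (Finset.mem_powersetCard.mp hT').2]
    _ ≤ ∑ S ∈ centers F n ℓ, ∑ S' ∈ centers F n ℓ, ∑ j ∈ Finset.Icc 1 L,
        ((ball ρ S ∩ ball ρ S').card : ℝ) ^ j * (M ^ (L - j) * M ^ (L - j)) *
          p ^ (2 * L - j) :=
        Finset.sum_le_sum fun S hS => Finset.sum_le_sum fun S' hS' =>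
          sum_sum_pow_card_union_sub_le _ _ L hp0 (hM S hS) (hM S' hS')
    _ = _ := by
        simp_rw [Finset.sum_mul]
        refine Eq.trans (Finset.sum_congr rfl fun S _ => ?_) Finset.sum_comm
        exact Finset.sum_comm

/-! ### Asymptotics -/

/-- The exponential rates of the second moment terms stay below the rate of the squared first
moment for all intersection sizes `1 ≤ j ≤ L`. -/
theorem eventually_rpow_pow_mul_lt {q N γ δ : ℝ} (hq : 1 < q) (hN : 1 < N) (hγ : 0 < γ)
    (hγ1 : γ < 1) (hδ : 0 < δ) :
    ∀ᶠ ε in 𝓝[>] (0 : ℝ), ∀ j : ℕ, 1 ≤ j → (j : ℝ) ≤ Real.logb q N / ε - δ →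
      (q ^ ε) ^ j * (1 + (N - 1) * γ ^ j) < N := by
  have hlogq : 0 < Real.log q := Real.log_pos hq
  have hq0 : 0 < q := by linarith
  set c := -Real.log γ * Real.logb q N with hc
  have hcpos : 0 < c := mul_pos (neg_pos.mpr (Real.log_neg hγ hγ1)) (Real.logb_pos hq hN)
  have hone : ∀ᶠ ε in 𝓝[>] (0 : ℝ), q ^ ε * (1 + (N - 1) * γ) < N := by
    have hcont : Tendsto (fun ε : ℝ => q ^ ε * (1 + (N - 1) * γ)) (𝓝 0)
        (𝓝 (q ^ (0 : ℝ) * (1 + (N - 1) * γ))) :=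
      ((Real.continuous_const_rpow hq0.ne').tendsto 0).mul_const _
    refine (hcont.mono_left nhdsWithin_le_nhds).eventually_lt_const ?_
    rw [Real.rpow_zero]
    nlinarith
  -- After multiplication by `ε` this compares the bound `2 ε² / c²` for `exp (-c / ε)` with the
  -- linear lower bound `ε δ log q` for `q ^ (ε δ) - 1`.
  have hend : ∀ᶠ ε in 𝓝[>] (0 : ℝ),
      (N - 1) * γ ^ (-δ) * (2 / c ^ 2) * ε < δ * Real.log q := by
    have hcont : Tendsto (fun ε : ℝ => (N - 1) * γ ^ (-δ) * (2 / c ^ 2) * ε) (𝓝 0)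
        (𝓝 ((N - 1) * γ ^ (-δ) * (2 / c ^ 2) * 0)) := tendsto_id.const_mul _
    refine (hcont.mono_left nhdsWithin_le_nhds).eventually_lt_const ?_
    rw [mul_zero]
    positivity
  filter_upwards [hone, hend, self_mem_nhdsWithin] with ε h1 h2 hε j hj1 hjL
  have hε : 0 < ε := hε
  have ha : 0 < q ^ ε := by positivity
  set f : ℝ → ℝ := fun x => (q ^ ε) ^ x * (1 + (N - 1) * γ ^ x) with hf
  set x₁ := Real.logb q N / ε - δ with hx₁
  -- `f` is the sum of the exponential `(q ^ ε) ^ x` and a positive multiple of `(q ^ ε * γ) ^ x`.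
  have hconv : ConvexOn ℝ Set.univ f := by
    have h := (convexOn_rpow_left ha).add
      ((convexOn_rpow_left (mul_pos ha hγ)).smul (sub_pos.mpr hN).le)
    refine h.congr fun x _ => ?_
    simp only [hf, Pi.add_apply, smul_eq_mul]
    rw [Real.mul_rpow ha.le hγ.le]
    ring
  have hf1 : f 1 < N := by
    simpa [hf] using h1
  have hfx : f x₁ < N := by
    have hpow : (q ^ ε) ^ x₁ = N / q ^ (ε * δ) := by
      rw [← Real.rpow_mul hq0.le, hx₁, mul_sub, mul_div_cancel₀ _ hε.ne', Real.rpow_sub hq0,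
        Real.rpow_logb hq0 hq.ne' (by linarith)]
    have hγx : γ ^ x₁ ≤ γ ^ (-δ) * (2 / c ^ 2) * ε ^ 2 := by
      have hexp : γ ^ (Real.logb q N / ε) = (Real.exp (c / ε))⁻¹ := by
        rw [Real.rpow_def_of_pos hγ, ← Real.exp_neg, hc]
        congr 1
        ring
      have hquad : (c / ε) ^ 2 / 2 ≤ Real.exp (c / ε) := by
        have := Real.quadratic_le_exp_of_nonneg (div_pos hcpos hε).le
        have := div_pos hcpos hε
        linarith
      have hinv : (Real.exp (c / ε))⁻¹ ≤ 2 / c ^ 2 * ε ^ 2 := by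
        refine (inv_anti₀ (by positivity) hquad).trans (le_of_eq ?_)
        field_simp
      rw [hx₁, sub_eq_neg_add, Real.rpow_add hγ, hexp, mul_assoc]
      gcongr
    have hlow : 1 + ε * δ * Real.log q ≤ q ^ (ε * δ) := by
      rw [Real.rpow_def_of_pos hq0]
      have := Real.add_one_le_exp (Real.log q * (ε * δ))
      linarith
    have hlt : 1 + (N - 1) * γ ^ x₁ < q ^ (ε * δ) := by
      refine lt_of_lt_of_le ?_ hlow
      have h3 := mul_le_mul_of_nonneg_left hγx (sub_pos.mpr hN).le
      have h4 := mul_lt_mul_of_pos_right h2 hε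
      nlinarith
    simp only [hf]
    rw [hpow, div_mul_eq_mul_div, div_lt_iff₀ (by positivity)]
    exact mul_lt_mul_of_pos_left hlt (by linarith)
  have hj : f j ≤ max (f 1) (f x₁) := by
    refine hconv.le_max_of_mem_Icc (Set.mem_univ _) (Set.mem_univ _) ⟨?_, hjL⟩
    exact_mod_cast hj1
  have := hj.trans_lt (max_lt hf1 hfx)
  simpa [hf, Real.rpow_natCast] using this

/-- This is the expected number of codewords in a ball, up to a polynomial factor. The hypothesis
`hh` makes the rate at most `1`, so the inclusion probability is not truncated. -/
theorem inclusionProb_mul_growth_pow {q ℓ : ℕ} {ρ ε : ℝ} (hq : 1 ≤ q)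
    (hh : 0 ≤ entropy q ℓ ρ + ε) (n : ℕ) :
    growth q ℓ ρ ^ n * (inclusionProb q n (1 - entropy q ℓ ρ - ε) : ℝ) = (((q : ℝ) ^ ε)⁻¹) ^ n := by
  have hq0 : (0 : ℝ) < q := by exact_mod_cast hq
  rw [coe_inclusionProb hq (by linarith), growth, Real.rpow_mul hq0.le, Real.rpow_natCast,
    ← mul_pow, ← Real.rpow_add hq0, ← Real.rpow_neg hq0.le]
  congr 2
  ring

theorem tendsto_const_mul_add_one_pow_mul_pow {r : ℝ} (hr : 0 ≤ r) (hr1 : r < 1) (K : ℝ) (m : ℕ) :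
    Tendsto (fun n : ℕ => K * ((n : ℝ) + 1) ^ m * r ^ n) atTop (𝓝 0) := by
  rcases hr.eq_or_lt with rfl | hr0
  · refine tendsto_const_nhds.congr' ?_
    filter_upwards [eventually_ge_atTop 1] with n hn
    simp [show n ≠ 0 by omega]
  have h := (tendsto_pow_const_mul_const_pow_of_lt_one m hr hr1).comp (tendsto_add_atTop_nat 1)
  have h2 := h.const_mul (K / r)
  rw [mul_zero] at h2
  refine h2.congr fun n => ?_
  simp only [Function.comp_apply]
  push_cast
  rw [pow_succ r n]
  field_simp

/-! ### From moment bounds to high probability -/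

section Main

variable {F : Type*} [Fintype F] {q ℓ : ℕ} {ρ : ℝ} (hq : Fintype.card F = q)
  (hℓ : 1 ≤ ℓ) (hρ : 0 < ρ) (hρ1 : ρ < 1) (hℓq : (ℓ : ℝ) < q) (hρq : ρ * q < q - ℓ)
include hq hℓ hρ hρ1 hℓq hρq

/-- The union bound is `(N * q ^ (-ε L)) ^ n`, and `hL` says exactly that its base is less than `1`.
-/
theorem withHighProb_isListRecoverable {ε : ℝ} (hε : 0 < ε) {L : ℕ}
    (hL : Real.logb q (q.choose ℓ) / ε < L) :
    WithHighProb F (1 - entropy q ℓ ρ - ε) fun _ C => IsListRecoverable ρ ℓ L C := by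
  have hℓq' : ℓ ≤ q := by exact_mod_cast hℓq.le
  have hq1 : (1 : ℝ) < q := by
    have : (1 : ℝ) ≤ ℓ := by exact_mod_cast hℓ
    linarith
  have hq0 : (0 : ℝ) < q := by linarith
  have hN : 0 < (q.choose ℓ : ℝ) := by exact_mod_cast Nat.choose_pos hℓq'
  have hent := entropy_pos hℓ hρ hρ1 hℓq hρq
  rw [withHighProb_iff]
  have hr : (q.choose ℓ : ℝ) * (((q : ℝ) ^ ε)⁻¹) ^ L < 1 := by
    rw [inv_pow, ← div_eq_mul_inv, div_lt_one (by positivity), ← Real.rpow_natCast,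
      ← Real.rpow_mul hq0.le]
    rw [div_lt_iff₀ hε] at hL
    calc (q.choose ℓ : ℝ) = (q : ℝ) ^ Real.logb q (q.choose ℓ) :=
          (Real.rpow_logb hq0 hq1.ne' hN).symm
      _ < _ := Real.rpow_lt_rpow_of_exponent_lt hq1 (by linarith)
  refine squeeze_zero (fun _ => measureReal_nonneg) (fun n => ?_)
    (tendsto_pow_atTop_nhds_zero_of_lt_one (by positivity) hr)
  refine (randomCode_real_not_isListRecoverable_le hρ.le L (hq ▸ hℓq') _ fun S hS =>
    card_ball_le hq hℓ hρ hρ1 hℓq hρq hS).trans (le_of_eq ?_)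
  rw [hq, inclusionProb_mul_growth_pow (by exact_mod_cast hq1.le) (by linarith), mul_pow, ← pow_mul,
    ← pow_mul, mul_comm n L]

/-- The second moment bound for the probability that a random code is list-recoverable. -/
theorem randomCode_real_isListRecoverable_le {ε : ℝ} (hε : 0 < ε) (L n : ℕ)
    (hn : 2 * L ≤ growth q ℓ ρ ^ n * ((1 - ρ) * tilt q ℓ ρ / (n + 1))) :
    (randomCode F n (1 - entropy q ℓ ρ - ε)).real {C | IsListRecoverable ρ ℓ L C} ≤
      ∑ j ∈ Finset.Icc 1 L, ((2 / ((1 - ρ) * tilt q ℓ ρ)) ^ L * L.factorial) ^ 2 *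
        ((n : ℝ) + 1) ^ (2 * L) *
        (((q : ℝ) ^ ε) ^ j * (1 + (q.choose ℓ - 1) * decay q ℓ ρ ^ j) / q.choose ℓ) ^ n := by
  classical
  have hℓ0 : (1 : ℝ) ≤ ℓ := by exact_mod_cast hℓ
  have hℓq' : ℓ ≤ q := by exact_mod_cast hℓq.le
  have hq1 : (1 : ℝ) < q := by linarith
  have hq0 : (0 : ℝ) < q := by linarith
  have hent := entropy_pos hℓ hρ hρ1 hℓq hρq
  have hV : 0 < growth q ℓ ρ := one_pos.trans (one_lt_growth hℓ hρ hρ1 hℓq hρq)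
  have h1ρ : 0 < 1 - ρ := by linarith
  have htpos := tilt_pos hℓ hρ hρ1 hℓq
  have hN : 0 < (q.choose ℓ : ℝ) := by exact_mod_cast Nat.choose_pos hℓq'
  set c := (1 - ρ) * tilt q ℓ ρ
  have hc : 0 < c := mul_pos h1ρ htpos
  set N : ℝ := (q.choose ℓ : ℝ)
  set V := growth q ℓ ρ
  set θ := (q : ℝ) ^ ε
  have hθ : 0 < θ := Real.rpow_pos_of_pos hq0 ε
  set p : ℝ := (inclusionProb q n (1 - entropy q ℓ ρ - ε) : ℝ) with hp
  have hVp : V ^ n * p = θ⁻¹ ^ n :=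
    inclusionProb_mul_growth_pow (by exact_mod_cast hq1.le) (by linarith) n
  have hp0 : 0 ≤ p := (inclusionProb q n (1 - entropy q ℓ ρ - ε)).2.1
  -- The polynomial loss in the first moment. Since `2 * L` is at most the size `b` of a ball, `b +
  -- 1 - L ≥ b / 2`, whence `b.choose L ≥ (b / 2) ^ L / L!`.
  set D : ℝ := (c / (2 * (n + 1))) ^ L / L.factorial with hD
  have hE : N ^ n * ((θ⁻¹ ^ n) ^ L * D) ≤
      ∑ S ∈ centers F n ℓ, ((ball ρ S).card.choose L : ℝ) * p ^ L := by
    have hN' : N ^ n = ((centers F n ℓ).card : ℝ) := by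
      rw [card_centers, hq]
      push_cast
      rfl
    rw [hN', ← nsmul_eq_mul]
    refine Finset.card_nsmul_le_sum _ _ _ fun S hS => ?_
    have hlow := growth_pow_mul_le_card_ball hq hℓ hρ hρ1 hℓq hρq hS
    have hb : 2 * L ≤ (ball ρ S).card := by exact_mod_cast hn.trans hlow
    have hhalf : V ^ n * (c / (n + 1)) / 2 ≤ (((ball ρ S).card + 1 - L : ℕ) : ℝ) := by
      rw [Nat.cast_sub (by omega)]
      have hb' : 2 * (L : ℝ) ≤ (ball ρ S).card := by exact_mod_cast hb
      push_cast
      linarith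
    calc (θ⁻¹ ^ n) ^ L * D = (V ^ n * (c / (n + 1)) / 2) ^ L / L.factorial * p ^ L := by
          rw [← hVp, hD, mul_div_assoc', div_mul_eq_mul_div, ← mul_pow, ← mul_pow]
          congr 2
          field_simp
      _ ≤ _ := by
          refine mul_le_mul_of_nonneg_right ?_ (by positivity)
          refine le_trans ?_ (Nat.pow_le_choose L (ball ρ S).card)
          gcongr
  have hmoment := randomCode_real_isListRecoverable_mul_sq_le hρ.le L (hq ▸ hℓq')
    (1 - entropy q ℓ ρ - ε) (n := n) (p := p) (by rw [hp, hq]) fun S hS =>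
      card_ball_le hq hℓ hρ hρ1 hℓq hρq hS
  have hE0 : 0 < N ^ n * ((θ⁻¹ ^ n) ^ L * D) := by positivity
  refine le_of_mul_le_mul_right ?_ (pow_pos hE0 2)
  refine (mul_le_mul_of_nonneg_left (pow_le_pow_left₀ hE0.le hE 2) measureReal_nonneg).trans
    (hmoment.trans ?_)
  rw [Finset.sum_mul]
  refine Finset.sum_le_sum fun j hj => ?_
  -- With `L = j + k` the powers of `V ^ n` and of `p` both become `j + 2 * k`, so they combine into
  -- powers of `V ^ n * p`. Division by the squared mean, of order `2 * L`, leaves `θ ^ j`.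
  obtain ⟨k, rfl⟩ := Nat.exists_eq_add_of_le (Finset.mem_Icc.mp hj).2
  have hsum := sum_card_ball_inter_ball_pow_le (n := n) hq hℓ hρ hρ1 hℓq hρq j
  rw [Nat.add_sub_cancel_left, show 2 * (j + k) - j = j + 2 * k by omega]
  calc _ ≤ (V ^ j * (N * (1 + (N - 1) * decay q ℓ ρ ^ j))) ^ n * ((V ^ n) ^ k * (V ^ n) ^ k) *
        p ^ (j + 2 * k) := by gcongr
    _ = (N * (1 + (N - 1) * decay q ℓ ρ ^ j)) ^ n * (V ^ n * p) ^ (j + 2 * k) := by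
        rw [mul_pow (V ^ j)]
        ring
    _ = _ := by
      rw [hVp, hD]
      generalize 1 + (N - 1) * decay q ℓ ρ ^ j = w
      have hfac : ((j + k).factorial : ℝ) ≠ 0 := by positivity
      simp only [div_pow, mul_pow, inv_pow]
      field_simp
      ring

theorem withHighProb_not_isListRecoverable {δ : ℝ} (hδ : 0 < δ) :
    ∀ᶠ ε in 𝓝[>] (0 : ℝ), WithHighProb F (1 - entropy q ℓ ρ - ε) fun _ C =>
      ¬ IsListRecoverable ρ ℓ ⌊Real.logb q (q.choose ℓ) / ε - δ⌋₊ C := by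
  have hℓ0 : (1 : ℝ) ≤ ℓ := by exact_mod_cast hℓ
  have hℓq' : ℓ < q := by exact_mod_cast hℓq
  have hq1 : (1 : ℝ) < q := by linarith
  have hγ := decay_pos hℓ hρ hρ1 hℓq hρq
  have hV := one_lt_growth hℓ hρ hρ1 hℓq hρq
  have htpos := tilt_pos hℓ hρ hρ1 hℓq
  have h1ρ : 0 < 1 - ρ := by linarith
  have hN : 1 < (q.choose ℓ : ℝ) := by
    have : 1 < q.choose ℓ := by
      refine lt_of_le_of_ne (Nat.choose_pos hℓq'.le) fun h => ?_
      rcases Nat.choose_eq_one_iff.mp h.symm with h | h <;> omega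
    exact_mod_cast this
  filter_upwards [eventually_rpow_pow_mul_lt hq1 hN hγ (decay_lt_one hℓ hρ1 hℓq hρq) hδ,
    self_mem_nhdsWithin] with ε hrate hε
  have hε : 0 < ε := hε
  set L := ⌊Real.logb q (q.choose ℓ) / ε - δ⌋₊ with hL
  rw [withHighProb_iff]
  simp only [not_not]
  refine squeeze_zero' (Eventually.of_forall fun _ => measureReal_nonneg) ?_
    (g := fun n : ℕ => ∑ j ∈ Finset.Icc 1 L,
      ((2 / ((1 - ρ) * tilt q ℓ ρ)) ^ L * L.factorial) ^ 2 * ((n : ℝ) + 1) ^ (2 * L) *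
        (((q : ℝ) ^ ε) ^ j * (1 + (q.choose ℓ - 1) * decay q ℓ ρ ^ j) / q.choose ℓ) ^ n) ?_
  -- Balls grow exponentially, so for large `n` they exceed the fixed size `2 * L`.
  · have hlim := tendsto_const_mul_add_one_pow_mul_pow (r := (growth q ℓ ρ)⁻¹)
      (by positivity) (inv_lt_one_of_one_lt₀ hV) (2 * L) 1
    filter_upwards [hlim.eventually_le_const (mul_pos h1ρ htpos)] with n hn
    refine randomCode_real_isListRecoverable_le hq hℓ hρ hρ1 hℓq hρq hε L n ?_
    rw [pow_one, inv_pow, ← div_eq_mul_inv, div_le_iff₀ (by positivity)] at hn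
    rw [mul_div_assoc', le_div_iff₀ (by positivity)]
    linarith
  · rw [show 𝓝 (0 : ℝ) = 𝓝 (∑ _j ∈ Finset.Icc 1 L, (0 : ℝ)) by simp]
    refine tendsto_finsetSum _ fun j hj => ?_
    rw [Finset.mem_Icc] at hj
    -- As `j ≠ 0`, this needs no sign condition on the floored number; if that is negative, the sum
    -- over `j` is empty.
    have hjL : (j : ℝ) ≤ Real.logb q (q.choose ℓ) / ε - δ := by
      refine (Nat.le_floor_iff' (by omega)).mp hj.2
    have hN1 : 0 < (q.choose ℓ : ℝ) - 1 := by linarith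
    refine tendsto_const_mul_add_one_pow_mul_pow (by positivity) ?_ _ _
    rw [div_lt_one (by linarith)]
    exact hrate j hj.1 hjL

end Main

end ListRecovery

end

open ListRecovery in
theorem mainTheorem2 {F : Type*} [Field F] [Fintype F] (q ℓ : ℕ) (hq : Fintype.card F = q)
    (hℓ : 1 ≤ ℓ) (hℓq : ℓ ≤ q) (ρ : ℝ) (hρ : 0 < ρ) (hρ' : ρ < 1 - (ℓ : ℝ) / q) :
    -- the list size `⌊log_q (q choose ℓ) / ε - δ⌋` is too small
    (∀ δ : ℝ, 0 < δ → ∃ ε₀ : ℝ, 0 < ε₀ ∧ ∀ ε : ℝ, 0 < ε → ε < ε₀ →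
      ListRecovery.WithHighProb F (1 - ListRecovery.entropy q ℓ ρ - ε) fun _ C =>
        ¬ ListRecovery.IsListRecoverable ρ ℓ ⌊Real.logb q (q.choose ℓ) / ε - δ⌋₊ C) ∧
    -- the list size `⌈log_q (q choose ℓ) / ε + 1⌉` is large enough
    (∀ ε : ℝ, 0 < ε →
      ListRecovery.WithHighProb F (1 - ListRecovery.entropy q ℓ ρ - ε) fun _ C =>
        ListRecovery.IsListRecoverable ρ ℓ ⌈Real.logb q (q.choose ℓ) / ε + 1⌉₊ C) ∧
    -- the smallest admissible list size has only two or three possible values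
    (∀ δ : ℝ, 0 < δ → δ < 1 → ∃ ε₀ : ℝ, 0 < ε₀ ∧ ∀ ε : ℝ, 0 < ε → ε < ε₀ →
      ListRecovery.WithHighProb F (1 - ListRecovery.entropy q ℓ ρ - ε) fun _ C =>
        ∃ L ∈ ({⌊Real.logb q (q.choose ℓ) / ε + (1 - δ)⌋₊, ⌈Real.logb q (q.choose ℓ) / ε⌉₊,
            ⌈Real.logb q (q.choose ℓ) / ε⌉₊ + 1} : Set ℕ),
          IsLeast {L' : ℕ | ListRecovery.IsListRecoverable ρ ℓ L' C} L) := by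
  obtain ⟨hρ1, hℓq', hρq⟩ := lt_of_lt_one_sub_div hρ hρ' hℓ hℓq
  have hq1 : (1 : ℝ) < q := by
    have : (1 : ℝ) ≤ ℓ := by exact_mod_cast hℓ
    linarith
  have hlog : 0 < Real.logb q (q.choose ℓ) := by
    refine Real.logb_pos hq1 ?_
    have hlt : ℓ < q := by exact_mod_cast hℓq'
    have : 1 < q.choose ℓ := by
      refine lt_of_le_of_ne (Nat.choose_pos hℓq) fun h => ?_
      rcases Nat.choose_eq_one_iff.mp h.symm with h | h <;> omega
    exact_mod_cast this
  have hlower : ∀ δ : ℝ, 0 < δ → ∃ ε₀ : ℝ, 0 < ε₀ ∧ ∀ ε : ℝ, 0 < ε → ε < ε₀ →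
      WithHighProb F (1 - entropy q ℓ ρ - ε) fun _ C =>
        ¬ IsListRecoverable ρ ℓ ⌊Real.logb q (q.choose ℓ) / ε - δ⌋₊ C := by
    intro δ hδ
    obtain ⟨ε₀, hε₀, h⟩ := mem_nhdsGT_iff_exists_Ioo_subset.mp
      (withHighProb_not_isListRecoverable hq hℓ hρ hρ1 hℓq' hρq hδ)
    exact ⟨ε₀, hε₀, fun ε h0 h1 => h ⟨h0, h1⟩⟩
  have hupper : ∀ ε : ℝ, 0 < ε → WithHighProb F (1 - entropy q ℓ ρ - ε) fun _ C =>
      IsListRecoverable ρ ℓ ⌈Real.logb q (q.choose ℓ) / ε + 1⌉₊ C := fun ε hε =>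
    withHighProb_isListRecoverable hq hℓ hρ hρ1 hℓq' hρq hε
      ((lt_add_one _).trans_le (Nat.le_ceil _))
  refine ⟨hlower, hupper, fun δ hδ hδ1 => ?_⟩
  obtain ⟨ε₀, hε₀, h⟩ := hlower δ hδ
  -- The second bound forces `a > 1 > δ`, so that `a - δ` is positive and natural-number floors
  -- commute with adding `1`.
  refine ⟨min ε₀ (Real.logb q (q.choose ℓ)), lt_min hε₀ hlog, fun ε hε hεlt => ?_⟩
  rw [lt_min_iff] at hεlt
  refine ((h ε hε hεlt.1).and (hupper ε hε)).mono fun n C hC => ?_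
  set a := Real.logb q (q.choose ℓ) / ε with ha
  have ha1 : 1 < a := (one_lt_div hε).mpr hεlt.2
  obtain ⟨hnot, hrec⟩ := hC
  have hleast := isLeast_csInf (s := {L' : ℕ | IsListRecoverable ρ ℓ L' C}) ⟨_, hrec⟩
  set L := sInf {L' : ℕ | IsListRecoverable ρ ℓ L' C}
  refine ⟨L, ?_, hleast⟩
  have hgt : ⌊a - δ⌋₊ < L := by
    by_contra hle
    exact hnot (IsListRecoverable.mono hleast.1 (not_lt.mp hle))
  have hle : L ≤ ⌈a⌉₊ + 1 := by
    rw [← Nat.ceil_add_one (by linarith)]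
    exact hleast.2 hrec
  have hfloor : ⌊a + (1 - δ)⌋₊ = ⌊a - δ⌋₊ + 1 := by
    rw [← Nat.floor_add_one (by linarith)]
    congr 1
    ring
  -- The least list size lies between `⌊a - δ⌋₊ + 1` and `⌈a⌉₊ + 1`; since `δ < 1`, no integer in
  -- this range is missed by the three listed values.
  have hceil : ⌈a⌉₊ ≤ ⌊a - δ⌋₊ + 2 := by
    rw [Nat.ceil_le]
    have := Nat.lt_floor_add_one (a - δ)
    push_cast
    linarith
  simp only [Set.mem_insert_iff, Set.mem_singleton_iff, hfloor]
  omega
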